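/- Let $\mathrm{PG}(6,2)$ be the projective space whose points are the one-dimensional linear subspaces of $\mathbb{F}_2^7$ (equivalently, the $127$ non-zero vectors of $\mathbb{F}_2^7$), and whose lines are the sets of points contained in a two-dimensional linear subspace (equivalently, the triples $\{x,y,x+y\}$ with $x\neq y$ non-zero). Let $\chi_2(7)$ denote the chromatic number of $\mathrm{PG}(6,2)$, that is, the minimum number of colors needed to color its points so that no line is monochromatic. Then $$\chi_2(7)=5.$$ -/

import Mathlib

/-- A hypergraph is `k`-colorable if its vertices can be colored with `k` colors so that no edge
is monochromatic, that is, every edge contains two vertices of different colors. -/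
def Hypergraph.Colorable {α : Type*} (H : Hypergraph α) (k : ℕ) : Prop :=
  ∃ c : H.vertexSet → Fin k, ∀ e ∈ H.edgeSet,
    ∃ x y : H.vertexSet, (x : α) ∈ e ∧ (y : α) ∈ e ∧ c x ≠ c y

/-- The chromatic number of a hypergraph: the least `k` for which it is `k`-colorable,
and `⊤` if there is none. -/
noncomputable def Hypergraph.chromaticNumber {α : Type*} (H : Hypergraph α) : ℕ∞ :=
  ⨅ k ∈ {k : ℕ | H.Colorable k}, (k : ℕ∞)

/-- The points of the projective space `PG(n - 1, K)`: the one-dimensional subspaces of `K ^ n`. -/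
abbrev PGPoint (K : Type*) [Field K] (n : ℕ) : Type _ :=
  Projectivization K (Fin n → K)

/-- The hypergraph whose vertices are all points of `PG(n - 1, K)` and whose edges are the point
sets of the `(t - 1)`-dimensional projective subspaces, i.e. of the `t`-dimensional linear
subspaces `W` of `K ^ n`. For `t = 2` the edges are the projective lines. -/
def pgHypergraph (K : Type*) [Field K] (t n : ℕ) : Hypergraph (PGPoint K n) where
  vertexSet := Set.univ
  edgeSet := {e | ∃ W : Submodule K (Fin n → K),
    Module.finrank K W = t ∧ e = {p : PGPoint K n | p.submodule ≤ W}}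
  subset_vertexSet_of_mem_edgeSet' := fun _ _ => Set.subset_univ _

/-- The chromatic number of `PG(n - 1, 2)`: the minimum number of colors needed to color its points
so that no line is monochromatic. -/
noncomputable def chiTwo (n : ℕ) : ℕ∞ :=
  (pgHypergraph (ZMod 2) 2 n).chromaticNumber

/-! For the lower bound, color the edge {s, t} of the complete graph on all 128 vectors of 𝔽₂⁷ by
the color of s + t. Since (s + t) + (s + u) = t + u, a monochromatic triangle would be a
monochromatic line. The pigeonhole argument behind the Ramsey bound for triangles allows at most 65
vertices with four colors (`card_le_triangleBound`), and 65 < 128. For the upper bound, an explicit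
5-coloring is checked by computation: points become the numbers 1 to 127 and vector addition becomes
bitwise XOR (`binaryCode_add`, `fiveColoring_xor`). Both halves use `pgHypergraph_two_colorable_iff`
to pass from lines to sums of vectors. -/

/-- The bound on the number of vertices of an edge-colored complete graph in `k` colors without
monochromatic triangle given by the pigeonhole argument. -/
def triangleBound : ℕ → ℕ
  | 0 => 1
  | k + 1 => (k + 1) * triangleBound k + 1

/-- In an elementary abelian `2`-group colored without monochromatic `{x, y, x + y}`, a set all of
whose differences have one of at most `k` colors has at most `triangleBound k` elements. -/
theorem card_le_triangleBound {A κ : Type*} [AddCommGroup A] [DecidableEq A] [DecidableEq κ]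
    (h2 : ∀ x : A, x + x = 0) (f : A → κ)
    (hf : ∀ x y : A, x ≠ 0 → y ≠ 0 → x ≠ y → f x = f y → f (x + y) ≠ f x) (k : ℕ) :
    ∀ (C : Finset κ) (S : Finset A), C.card ≤ k →
      (∀ s ∈ S, ∀ t ∈ S, s ≠ t → f (s + t) ∈ C) → S.card ≤ triangleBound k := by
  have add_ne : ∀ {x y : A}, x ≠ y → x + y ≠ 0 := fun {x y} hxy h =>
    hxy ((eq_neg_of_add_eq_zero_left h).trans (neg_eq_of_add_eq_zero_left (h2 y)))
  induction k with
  | zero =>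
    intro C S hC hS
    obtain rfl : C = ∅ := Finset.card_eq_zero.mp (Nat.le_zero.mp hC)
    refine Finset.card_le_one.mpr fun s hs t ht => ?_
    by_contra hst
    simpa using hS s hs t ht hst
  | succ k ih =>
    intro C S hC hS
    rcases S.eq_empty_or_nonempty with rfl | ⟨s, hs⟩
    · simp
    -- Pigeonhole at the vertex s: its neighbors are split by the color of the edge joining them to
    -- s.
    have hsub : S.erase s ⊆ C.biUnion fun c => (S.erase s).filter fun t => f (s + t) = c := by
      intro t ht
      have ht' := Finset.mem_erase.mp ht
      exact Finset.mem_biUnion.mpr ⟨_, hS s hs t ht'.2 ht'.1.symm, Finset.mem_filter.mpr ⟨ht, rfl⟩⟩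
    have hle : (S.erase s).card ≤ C.card * triangleBound k := by
      refine (Finset.card_le_card hsub).trans (Finset.card_biUnion_le_card_mul _ _ _ fun c hc => ?_)
      -- Two neighbors of s in the class of c cannot be joined by color c, so one color fewer
      -- remains inside the class.
      refine ih (C.erase c) _ (by rw [Finset.card_erase_of_mem hc]; omega) fun t ht u hu htu => ?_
      simp only [Finset.mem_filter, Finset.mem_erase] at ht hu
      refine Finset.mem_erase.mpr ⟨fun h => ?_, hS t ht.1.2 u hu.1.2 htu⟩
      have key : (s + t) + (s + u) = t + u := by
        rw [add_add_add_comm, h2, zero_add]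
      exact hf (s + t) (s + u) (add_ne ht.1.1.symm) (add_ne hu.1.1.symm)
        (fun e => htu (add_left_cancel e)) (ht.2.trans hu.2.symm) (by rw [key, h, ht.2])
    have h1 := Finset.card_erase_add_one hs
    have h3 := Nat.mul_le_mul_right (triangleBound k) hC
    simp only [triangleBound]
    omega

theorem zmod_two_eq_one {a : ZMod 2} (ha : a ≠ 0) : a = 1 := by
  revert a; decide

theorem add_self_eq_zero_of_zmod_two {M : Type*} [AddCommGroup M] [Module (ZMod 2) M] (x : M) :
    x + x = 0 := by
  rw [← two_smul (ZMod 2) x, show (2 : ZMod 2) = 0 from rfl, zero_smul]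

theorem linearIndependent_pair_zmod_two {M : Type*} [AddCommGroup M] [Module (ZMod 2) M] {x y : M}
    (hx : x ≠ 0) (hy : y ≠ 0) (hxy : x ≠ y) : LinearIndependent (ZMod 2) ![x, y] := by
  refine (LinearIndependent.pair_iff' hx).mpr fun a h => ?_
  by_cases ha : a = 0
  · exact hy (by rw [← h, ha, zero_smul])
  · exact hxy (by rw [← h, zmod_two_eq_one ha, one_smul])

theorem mem_span_pair_zmod_two {M : Type*} [AddCommGroup M] [Module (ZMod 2) M] {x y z : M}
    (hz : z ∈ Submodule.span (ZMod 2) {x, y}) (h0 : z ≠ 0) : z = x ∨ z = y ∨ z = x + y := by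
  obtain ⟨a, b, rfl⟩ := Submodule.mem_span_pair.mp hz
  by_cases ha : a = 0 <;> by_cases hb : b = 0
  · simp [ha, hb] at h0
  · simp [ha, zmod_two_eq_one hb]
  · simp [hb, zmod_two_eq_one ha]
  · simp [zmod_two_eq_one ha, zmod_two_eq_one hb]

theorem projectivization_rep_mk_zmod_two {M : Type*} [AddCommGroup M] [Module (ZMod 2) M] {x : M}
    (hx : x ≠ 0) : (Projectivization.mk (ZMod 2) x hx).rep = x := by
  obtain ⟨a, ha⟩ := Projectivization.exists_smul_eq_mk_rep (ZMod 2) x hx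
  rw [← ha, Units.smul_def, zmod_two_eq_one a.ne_zero, one_smul]

/-- `PG(n - 1, 2)` is `k`-colorable iff the non-zero vectors of `𝔽₂ⁿ` can be colored with `k` colors
so that no `{x, y, x + y}` is monochromatic. -/
theorem pgHypergraph_two_colorable_iff {n k : ℕ} [NeZero k] :
    (pgHypergraph (ZMod 2) 2 n).Colorable k ↔
      ∃ f : (Fin n → ZMod 2) → Fin k,
        ∀ x y, x ≠ 0 → y ≠ 0 → x ≠ y → f x = f y → f (x + y) ≠ f x := by
  constructor
  · rintro ⟨c, hc⟩
    -- The color given to 0 is a dummy: the condition only involves nonzero vectors.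
    refine ⟨fun v => if hv : v = 0 then 0 else c ⟨Projectivization.mk (ZMod 2) v hv, trivial⟩,
      fun x y hx hy hxy hfxy hfx => ?_⟩
    have hxy0 : x + y ≠ 0 := fun h => hxy (by
      rw [← add_zero x, ← add_self_eq_zero_of_zmod_two y, ← add_assoc, h, zero_add])
    simp only [hx, hy, hxy0, dif_neg, not_false_eq_true] at hfxy hfx
    have hrank : Module.finrank (ZMod 2) (Submodule.span (ZMod 2) {x, y}) = 2 := by
      have := finrank_span_eq_card (linearIndependent_pair_zmod_two hx hy hxy)
      rwa [Matrix.range_cons_cons_empty, Fintype.card_fin] at this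
    obtain ⟨p, q, hp, hq, hpq⟩ := hc _ ⟨_, hrank, rfl⟩
    -- The points of the line are x, y and x + y, all of the color of x by assumption, so no two
    -- points of it differ in color.
    have aux : ∀ p : (pgHypergraph (ZMod 2) 2 n).vertexSet,
        (p : PGPoint (ZMod 2) n).submodule ≤ Submodule.span (ZMod 2) {x, y} →
          c p = c ⟨Projectivization.mk (ZMod 2) x hx, trivial⟩ := by
      rintro ⟨p, hp'⟩ hp
      induction p using Projectivization.ind with
      | h v hv =>
        rw [Projectivization.submodule_mk, Submodule.span_singleton_le_iff_mem] at hp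
        rcases mem_span_pair_zmod_two hp hv with rfl | rfl | rfl
        · rfl
        · exact hfxy.symm
        · exact hfx
    exact hpq ((aux p hp).trans (aux q hq).symm)
  · rintro ⟨f, hf⟩
    refine ⟨fun p => f (p : PGPoint (ZMod 2) n).rep, ?_⟩
    rintro _ ⟨W, hW, rfl⟩
    let b := Module.finBasisOfFinrankEq (ZMod 2) W hW
    have mem : ∀ (v : Fin n → ZMod 2) (hv : v ≠ 0), v ∈ W →
        Projectivization.mk (ZMod 2) v hv ∈ {p : PGPoint (ZMod 2) n | p.submodule ≤ W} := by
      intro v hv hvW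
      rwa [Set.mem_ofPred_eq, Projectivization.submodule_mk, Submodule.span_singleton_le_iff_mem]
    have hx : (b 0 : Fin n → ZMod 2) ≠ 0 := by simpa using b.ne_zero 0
    have hy : (b 1 : Fin n → ZMod 2) ≠ 0 := by simpa using b.ne_zero 1
    have hxy : (b 0 : Fin n → ZMod 2) ≠ b 1 := fun h =>
      absurd (b.injective (Subtype.ext h)) (by decide)
    have hxy0 : (b 0 + b 1 : Fin n → ZMod 2) ≠ 0 := fun h => hxy (by
      rw [← add_zero (b 0 : Fin n → ZMod 2), ← add_self_eq_zero_of_zmod_two (b 1 : Fin n → ZMod 2),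
        ← add_assoc, h, zero_add])
    -- If the two basis vectors share a color, their sum has another one; otherwise they are
    -- themselves the required pair.
    by_cases h : f (b 0) = f (b 1)
    · refine ⟨⟨.mk _ _ hxy0, trivial⟩, ⟨.mk _ _ hx, trivial⟩,
        mem _ _ (W.add_mem (b 0).2 (b 1).2), mem _ _ (b 0).2, ?_⟩
      simpa only [projectivization_rep_mk_zmod_two] using hf _ _ hx hy hxy h
    · refine ⟨⟨.mk _ _ hx, trivial⟩, ⟨.mk _ _ hy, trivial⟩, mem _ _ (b 0).2, mem _ _ (b 1).2, ?_⟩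
      simpa only [projectivization_rep_mk_zmod_two] using h

theorem five_le_of_pgHypergraph_colorable {k : ℕ}
    (h : (pgHypergraph (ZMod 2) 2 7).Colorable k) : 5 ≤ k := by
  by_contra hk
  obtain ⟨c, hc⟩ := h
  -- Unused colors are harmless, so fewer than five colors may be taken to be exactly four.
  have h4 : (pgHypergraph (ZMod 2) 2 7).Colorable 4 := by
    refine ⟨fun p => Fin.castLE (by omega) (c p), fun e he => ?_⟩
    obtain ⟨x, y, hx, hy, hxy⟩ := hc e he
    exact ⟨x, y, hx, hy, fun h => hxy (Fin.castLE_injective _ h)⟩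
  obtain ⟨f, hf⟩ := pgHypergraph_two_colorable_iff.mp h4
  -- With all four colors and all vectors, this reads 128 ≤ 65.
  have := card_le_triangleBound add_self_eq_zero_of_zmod_two f hf 4 Finset.univ Finset.univ
    (by simp) (fun _ _ _ _ _ => Finset.mem_univ _)
  simp [triangleBound] at this

/-- The number whose binary digits are the entries of a vector over `𝔽₂`. -/
def binaryCode {n : ℕ} (v : Fin n → ZMod 2) : ℕ :=
  Nat.ofBits fun i => decide (v i ≠ 0)

theorem binaryCode_lt {n : ℕ} (v : Fin n → ZMod 2) : binaryCode v < 2 ^ n :=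
  Nat.ofBits_lt_two_pow _

/-- Needed to carry `v ≠ 0` and `x ≠ y` over to the codes. -/
theorem binaryCode_injective {n : ℕ} :
    Function.Injective (binaryCode : (Fin n → ZMod 2) → ℕ) := by
  intro v w h
  funext i
  have := congrArg (fun m => m.testBit i) h
  simp only [binaryCode, Nat.testBit_ofBits_lt _ _ i.isLt, Fin.eta] at this
  generalize v i = a at *
  generalize w i = b at *
  revert a b; decide

theorem decide_add_ne_zero_zmod_two :
    ∀ a b : ZMod 2, decide (a + b ≠ 0) = (decide (a ≠ 0) ^^ decide (b ≠ 0)) := by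
  decide

theorem binaryCode_add {n : ℕ} (v w : Fin n → ZMod 2) :
    binaryCode (v + w) = binaryCode v ^^^ binaryCode w := by
  refine Nat.eq_of_testBit_eq fun i => ?_
  rw [Nat.testBit_xor]
  rcases lt_or_ge i n with hi | hi
  · simp only [binaryCode, Nat.testBit_ofBits_lt _ _ hi, Pi.add_apply]
    exact decide_add_ne_zero_zmod_two _ _
  · simp only [binaryCode, Nat.testBit_ofBits_ge _ _ hi, Bool.xor_false]

theorem binaryCode_zero {n : ℕ} : binaryCode (0 : Fin n → ZMod 2) = 0 := by
  rw [← add_zero (0 : Fin n → ZMod 2), binaryCode_add, Nat.xor_self]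

/-- A coloring of the binary codes of the points of `PG(6, 2)` with five colors, packed as the
base `5` digits of a number. -/
def fiveColoring (m : ℕ) : ℕ :=
  114889897306036295146003885567007024964692512931241213735852219128791758462843988614014295 / 5 ^ m % 5

/-- A finite check over all pairs of 7-bit codes, evaluated by the kernel. -/
theorem fiveColoring_xor : ∀ x < 128, ∀ y < 128,
    x ≠ 0 ∧ y ≠ 0 ∧ x ≠ y ∧ fiveColoring x = fiveColoring y →
      fiveColoring (x ^^^ y) ≠ fiveColoring x := by
  decide +kernel

theorem pgHypergraph_colorable_five : (pgHypergraph (ZMod 2) 2 7).Colorable 5 := by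
  refine pgHypergraph_two_colorable_iff.mpr
    ⟨fun v => ⟨fiveColoring (binaryCode v), Nat.mod_lt _ (by norm_num)⟩,
      fun x y hx hy hxy h => ?_⟩
  have hne : ∀ {v : Fin 7 → ZMod 2}, v ≠ 0 → binaryCode v ≠ 0 := fun hv h =>
    hv (binaryCode_injective (h.trans binaryCode_zero.symm))
  refine fun e => fiveColoring_xor _ (binaryCode_lt x) _ (binaryCode_lt y)
    ⟨hne hx, hne hy, fun e => hxy (binaryCode_injective e), congrArg Fin.val h⟩ ?_
  simpa only [binaryCode_add] using congrArg Fin.val e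

theorem mainTheorem6 : chiTwo 7 = 5 := by
  refine le_antisymm (iInf₂_le 5 pgHypergraph_colorable_five) (le_iInf₂ fun k hk => ?_)
  exact_mod_cast five_le_of_pgHypergraph_colorable hk
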